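/- Let $\mathcal E$ be a (Barr) exact category and let $\mathcal P$ be a projective cover of $\mathcal E$, i.e. a full subcategory of $\mathcal E$ (given, up to equivalence, by a fully faithful functor $\mathcal P\to\mathcal E$) whose objects are regular projective in $\mathcal E$ and such that every object $A$ of $\mathcal E$ admits a regular epimorphism $X\to A$ with $X\in\mathcal P$. (Equivalently, $\mathcal P$ is a category with weak finite limits and $\mathcal E$ is its exact completion.) A weak limit of a diagram is a cone over it to which every cone over the diagram admits a (not necessarily unique) morphism; a weak pullback is a weak limit of a cospan. A pair $y_1,y_2\colon Y_1\rightrightarrows Y_0$ in $\mathcal P$ is a pseudo equivalence relation if there are arrows $r\colon Y_0\to Y_1$ with $y_1r=y_2r=\mathrm{id}$, $s\colon Y_1\to Y_1$ with $y_1s=y_2$ and $y_2s=y_1$, and $t\colon T\to Y_1$ with $y_1t=y_1a$ and $y_2t=y_2b$, where $a,b\colon T\rightrightarrows Y_1$ is a weak pullback of $y_2$ and $y_1$ (so $y_2a=y_1b$). For a weak pullback $X\xleftarrow{p}V\xrightarrow{q}W$ over $J$, an arrow $e\colon V\to Y_0$ preserves projections with respect to $y_1,y_2$ if, for a pair $v_1,v_2\colon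 V_1\rightrightarrows V$ weakly universal among pairs with $pv_1=pv_2$ and $qv_1=qv_2$, there is $t\colon V_1\to Y_1$ with $y_1t=ev_1$ and $y_2t=ev_2$. Given a pseudo equivalence relation $y_1,y_2\colon Y_1\rightrightarrows Y_0$ and arrows $Y_0\xrightarrow{g}X\xrightarrow{f}J$ in $\mathcal P$ with $gy_1=gy_2$, consider the tuples $(W,V,w,q,p,e)$ consisting of objects $W,V$ of $\mathcal P$ and arrows $w\colon W\to J$, $q\colon V\to W$, $p\colon V\to X$, $e\colon V\to Y_0$ of $\mathcal P$ such that $ge=p$, the square $fp=wq$ is a weak pullback, and $e$ preserves projections with respect to $y_1,y_2$. Such a tuple is a generalised weak dependent product of $g$ along $f$ with respect to $y_1,y_2$ if for every other such tuple $(W',V',w',q',p',e')$ there are arrows $\alpha\colon W'\to W$ and $\beta\colon V'\to V$ with $w\alpha=w'$, $q\beta=\alpha q'$, $p\beta=p'$ and $e\beta=e'$. The category $\mathcal P$ is weakly locally cartesian closed if it has weak finite limits and a generalised weak dependent product exists for all such $y_1,y_2,g,f$. **Theorem.** $\mathcal E$ is locally cartesian closed (every slice $\mathcal E/I$, for $I$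 an object of $\mathcal E$, is cartesian closed) if and only if $\mathcal P$ is weakly locally cartesian closed. -/

import Mathlib

open CategoryTheory CategoryTheory.Limits

universe v u v₁ u₁ v₂ u₂

namespace WeakLCC

section Exact

variable (E : Type u) [Category.{v} E]

/-- A (Barr) exact category: a regular category (finite limits, coequalisers of kernel pairs,
pullback-stable regular epimorphisms) in which every internal equivalence relation is effective. -/
class IsExact : Prop extends Regular E where
  effective : ∀ {R A : E} (p₁ p₂ : R ⟶ A), IsEquivalenceRelation p₁ p₂ →
    IsEffectiveEquivalenceRelation p₁ p₂

/-- `E` is locally cartesian closed: every slice `E/I` is cartesian closed. The monoidal structure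
on `Over I` is the cartesian one, given by pullbacks over `I`. -/
def IsLocallyCartesianClosed [HasPullbacks E] : Prop :=
  ∀ I : E, Nonempty
    (@MonoidalClosed (Over I) _ (Over.cartesianMonoidalCategory I).toMonoidalCategory)

variable {E}

/-- `X` is (regular) projective: `E(X, -)` sends regular epimorphisms to surjections. -/
def IsRegularProjective (X : E) : Prop :=
  ∀ ⦃A B : E⦄ (e : A ⟶ B), IsRegularEpi e → ∀ f : X ⟶ B, ∃ l : X ⟶ A, l ≫ e = f

/-- The fully faithful functor `F` exhibits `C` as (equivalent to) a full subcategory of `E` which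
is a projective cover of `E`: all its objects are regular projective in `E`, and every object of
`E` is covered, through a regular epimorphism, by one of them. -/
structure IsProjectiveCover {C : Type u₁} [Category.{v₁} C] (F : C ⥤ E) : Prop where
  full : F.Full
  faithful : F.Faithful
  projective : ∀ X : C, IsRegularProjective (F.obj X)
  exists_cover : ∀ A : E, ∃ (X : C) (p : F.obj X ⟶ A), IsRegularEpi p

end Exact

section Weak

variable (C : Type u) [Category.{v} C]

/-- Every finite diagram in `C` has a weak limit: a cone which receives some (not necessarily
unique) morphism from each cone over the diagram. -/
def HasWeakFiniteLimits : Prop :=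
  ∀ (K : Type) [SmallCategory K] [FinCategory K] (D : K ⥤ C),
    ∃ c : Cone D, ∀ s : Cone D, Nonempty (s ⟶ c)

variable {C}

/-- The square `p ≫ f = q ≫ g` is a weak pullback. -/
structure IsWeakPullback {V X W J : C} (p : V ⟶ X) (q : V ⟶ W) (f : X ⟶ J) (g : W ⟶ J) :
    Prop where
  w : p ≫ f = q ≫ g
  exists_lift : ∀ ⦃T : C⦄ (a : T ⟶ X) (b : T ⟶ W), a ≫ f = b ≫ g →
    ∃ t : T ⟶ V, t ≫ p = a ∧ t ≫ q = b

/-- `r₁, r₂ : R ⇉ A` is a pseudo equivalence relation: it has a reflexivity, a symmetry and a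
transitivity morphism, the latter defined on a weak pullback of `r₂` and `r₁`; the pair `r₁, r₂`
need not be jointly monic. -/
structure IsPseudoEquivalenceRelation {R A : C} (r₁ r₂ : R ⟶ A) : Prop where
  refl : ∃ r : A ⟶ R, r ≫ r₁ = 𝟙 A ∧ r ≫ r₂ = 𝟙 A
  symm : ∃ s : R ⟶ R, s ≫ r₁ = r₂ ∧ s ≫ r₂ = r₁
  trans : ∃ (T : C) (a b : T ⟶ R), IsWeakPullback a b r₂ r₁ ∧
    ∃ t : T ⟶ R, t ≫ r₁ = a ≫ r₁ ∧ t ≫ r₂ = b ≫ r₂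

/-- `v₁, v₂ : V₁ ⇉ V` is an equality for the span `p, q`: it is weakly universal among the pairs of
parallel morphisms into `V` which are equalised by both `p` and `q`, i.e. a weak limit of the
diagram formed by two copies of `V` over `X` and `W`. -/
structure IsEquality {V₁ V X W : C} (p : V ⟶ X) (q : V ⟶ W) (v₁ v₂ : V₁ ⟶ V) : Prop where
  w_left : v₁ ≫ p = v₂ ≫ p
  w_right : v₁ ≫ q = v₂ ≫ q
  exists_lift : ∀ ⦃T : C⦄ (a b : T ⟶ V), a ≫ p = b ≫ p → a ≫ q = b ≫ q →
    ∃ t : T ⟶ V₁, t ≫ v₁ = a ∧ t ≫ v₂ = b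

/-- `e : V ⟶ Z₀` preserves the projections `p, q` of `V` with respect to `z₁, z₂ : Z₁ ⇉ Z₀`. -/
def PreservesProjections {V X W Z₁ Z₀ : C} (p : V ⟶ X) (q : V ⟶ W) (z₁ z₂ : Z₁ ⟶ Z₀)
    (e : V ⟶ Z₀) : Prop :=
  ∃ (V₁ : C) (v₁ v₂ : V₁ ⟶ V), IsEquality p q v₁ v₂ ∧
    ∃ t : V₁ ⟶ Z₁, t ≫ z₁ = v₁ ≫ e ∧ t ≫ z₂ = v₂ ≫ e

/-- The commutative diagrams
```
  Y₀ <-e-- V --q--> W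
    \      |        |
     g     p        w
      \--> X --f--> J
```
whose square is a weak pullback and in which `e` preserves projections with respect to
`y₁, y₂ : Y₁ ⇉ Y₀`. -/
structure DependentProductDiagram {Y₁ Y₀ X J : C} (y₁ y₂ : Y₁ ⟶ Y₀) (g : Y₀ ⟶ X) (f : X ⟶ J) where
  W : C
  V : C
  w : W ⟶ J
  q : V ⟶ W
  p : V ⟶ X
  e : V ⟶ Y₀
  comm : e ≫ g = p
  isWeakPullback : IsWeakPullback p q f w
  preservesProjections : PreservesProjections p q y₁ y₂ e

/-- The diagram `D` is a generalised weak dependent product of `g` along `f` with respect to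
`y₁, y₂`: every other diagram of the same kind maps to it. -/
def DependentProductDiagram.IsGeneralisedWeakDependentProduct {Y₁ Y₀ X J : C} {y₁ y₂ : Y₁ ⟶ Y₀}
    {g : Y₀ ⟶ X} {f : X ⟶ J} (D : DependentProductDiagram y₁ y₂ g f) : Prop :=
  ∀ D' : DependentProductDiagram y₁ y₂ g f, ∃ (a : D'.W ⟶ D.W) (b : D'.V ⟶ D.V),
    a ≫ D.w = D'.w ∧ b ≫ D.q = D'.q ≫ a ∧ b ≫ D.p = D'.p ∧ b ≫ D.e = D'.e

variable (C)

/-- `C` has generalised weak dependent products. -/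
def HasGeneralisedWeakDependentProducts : Prop :=
  ∀ ⦃Y₁ Y₀ X J : C⦄ (y₁ y₂ : Y₁ ⟶ Y₀), IsPseudoEquivalenceRelation y₁ y₂ →
    ∀ (g : Y₀ ⟶ X) (f : X ⟶ J), y₁ ≫ g = y₂ ≫ g →
      ∃ D : DependentProductDiagram y₁ y₂ g f, D.IsGeneralisedWeakDependentProduct

/-- `C` is weakly locally cartesian closed: it is a category with weak finite limits which has
generalised weak dependent products. -/
structure IsWeaklyLocallyCartesianClosed : Prop where
  hasWeakFiniteLimits : HasWeakFiniteLimits C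
  hasGeneralisedWeakDependentProducts : HasGeneralisedWeakDependentProducts C

end Weak

end WeakLCC

/-! Every object of `E` is the quotient of an object of `P` by a pseudo equivalence relation. If
`y₁, y₂` presents `y : F Y₀ ⟶ Y`, a diagram on `g, f` represents a morphism over `F X` from the
pullback of `F f` and `F w` to `Y`: the weak pullback `V` covers the true one, and preservation of
projections makes `F e` followed by `y` descend along that cover. Generalised weak dependent
products are thus weak dependent products in `E` of arbitrary `Y ⟶ F X` along arrows of `P`, tested
on objects of `P`.

If `E` is locally cartesian closed, exactness turns the pseudo equivalence relation into an object
`Y`; a cover of the true dependent product by an object of `P`, with a representative of its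
evaluation, is the diagram sought.

Conversely, the image of a weak dependent product of a monomorphism is a genuine universal
quantifier, so equality of two morphisms can be quantified along any arrow (`exists_forall_eq`).
This is used twice: to cut a weak exponential out of a weak dependent product over a cover of the
exponent, keeping the functions that descend (`exists_weakExponential`), and to define on it the
relation "same evaluation". The quotient by that relation, effective by exactness, is the
exponential (`exists_exponential`). -/

namespace WeakLCC

/-! ### Descent along strong and regular epimorphisms -/

section Covers

variable {E : Type u₂} [Category.{v₂} E]

/-- Factoring through a monomorphism is local for strong epimorphisms. -/
theorem exists_factor_of_strongEpi {T' T M B : E} (p : T' ⟶ T) [StrongEpi p] (m : M ⟶ B) [Mono m]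
    {t : T ⟶ B} {l : T' ⟶ M} (h : l ≫ m = p ≫ t) : ∃ s : T ⟶ M, s ≫ m = t :=
  have sq : CommSq l p m t := ⟨h⟩
  ⟨sq.lift, sq.fac_right⟩

theorem isRegularEpi_of_comp [Regular E] {A B C : E} (f : A ⟶ B) (g : B ⟶ C)
    [IsRegularEpi (f ≫ g)] : IsRegularEpi g :=
  have : StrongEpi g := strongEpi_of_strongEpi f g
  inferInstance

theorem isRegularEpi_comp [Regular E] {A B C : E} (f : A ⟶ B) (g : B ⟶ C)
    [IsRegularEpi f] [IsRegularEpi g] : IsRegularEpi (f ≫ g) :=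
  inferInstance

end Covers

/-! ### Weak limits in `P` as covers of limits in `E` -/

namespace IsProjectiveCover

variable {P : Type u₁} [Category.{v₁} P] {E : Type u₂} [Category.{v₂} E] {F : P ⥤ E}

theorem exists_map_eq (hF : IsProjectiveCover F) {X Y : P} (f : F.obj X ⟶ F.obj Y) :
    ∃ g : X ⟶ Y, F.map g = f :=
  have := hF.full
  F.map_surjective f

theorem map_inj (hF : IsProjectiveCover F) {X Y : P} {f g : X ⟶ Y} (h : F.map f = F.map g) :
    f = g :=
  have := hF.faithful
  F.map_injective h

theorem exists_lift (hF : IsProjectiveCover F) {X : P} {A B : E} (p : A ⟶ B) [hp : IsRegularEpi p]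
    (f : F.obj X ⟶ B) : ∃ l : F.obj X ⟶ A, l ≫ p = f :=
  hF.projective X p hp f

theorem exists_lift_map (hF : IsProjectiveCover F) {X Y : P} {B : E} (p : F.obj Y ⟶ B)
    [hp : IsRegularEpi p] (f : F.obj X ⟶ B) : ∃ l : X ⟶ Y, F.map l ≫ p = f := by
  obtain ⟨l, hl⟩ := hF.projective X p hp f
  obtain ⟨l, rfl⟩ := hF.exists_map_eq l
  exact ⟨l, hl⟩

/-- Every generalised element of the target of a regular epimorphism lifts to the source, after
passing to a projective cover of its domain. -/
theorem exists_cover_lift (hF : IsProjectiveCover F) {A B T : E} (p : A ⟶ B) [IsRegularEpi p]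
    (t : T ⟶ B) : ∃ (S : P) (c : F.obj S ⟶ T) (l : F.obj S ⟶ A), IsRegularEpi c ∧
      l ≫ p = c ≫ t := by
  obtain ⟨S, c, hc⟩ := hF.exists_cover T
  obtain ⟨l, hl⟩ := hF.exists_lift p (c ≫ t)
  exact ⟨S, c, l, hc, hl⟩

variable [Regular E]

/-- A cover of the true pullback by an object of `P` factors through `V` by weak universality, so
the comparison is the last factor of a regular epimorphism. -/
theorem isRegularEpi_lift (hF : IsProjectiveCover F) {V X W J : P} {p : V ⟶ X} {q : V ⟶ W}
    {f : X ⟶ J} {w : W ⟶ J} (h : IsWeakPullback p q f w)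
    (hw : F.map p ≫ F.map f = F.map q ≫ F.map w) :
    IsRegularEpi (pullback.lift (F.map p) (F.map q) hw) := by
  obtain ⟨S, c, hc⟩ := hF.exists_cover (pullback (F.map f) (F.map w))
  obtain ⟨a, ha⟩ := hF.exists_map_eq (c ≫ pullback.fst _ _)
  obtain ⟨b, hb⟩ := hF.exists_map_eq (c ≫ pullback.snd _ _)
  obtain ⟨t, rfl, rfl⟩ := h.exists_lift a b
    (hF.map_inj (by simp only [F.map_comp, ha, hb, Category.assoc, pullback.condition]))
  have : F.map t ≫ pullback.lift (F.map p) (F.map q) hw = c := by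
    ext
    · rw [Category.assoc, pullback.lift_fst, ← F.map_comp, ha]
    · rw [Category.assoc, pullback.lift_snd, ← F.map_comp, hb]
  have : IsRegularEpi (F.map t ≫ pullback.lift (F.map p) (F.map q) hw) := this ▸ hc
  exact isRegularEpi_of_comp (F.map t) _

theorem isWeakPullback_of_isRegularEpi (hF : IsProjectiveCover F) {V X W J : P} {p : V ⟶ X}
    {q : V ⟶ W} {f : X ⟶ J} {w : W ⟶ J} (π : F.obj V ⟶ pullback (F.map f) (F.map w))
    [IsRegularEpi π] (hp : π ≫ pullback.fst _ _ = F.map p) (hq : π ≫ pullback.snd _ _ = F.map q) :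
    IsWeakPullback p q f w where
  w := hF.map_inj (by simp only [F.map_comp, ← hp, ← hq, Category.assoc, pullback.condition])
  exists_lift T a b h := by
    obtain ⟨t, ht⟩ := hF.exists_lift_map π
      (pullback.lift (F.map a) (F.map b) (by simp only [← F.map_comp, h]))
    refine ⟨t, hF.map_inj ?_, hF.map_inj ?_⟩
    · rw [F.map_comp, ← hp, reassoc_of% ht, pullback.lift_fst]
    · rw [F.map_comp, ← hq, reassoc_of% ht, pullback.lift_snd]

theorem exists_isWeakPullback (hF : IsProjectiveCover F) {X W J : P} (f : X ⟶ J) (w : W ⟶ J) :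
    ∃ (V : P) (p : V ⟶ X) (q : V ⟶ W), IsWeakPullback p q f w := by
  obtain ⟨V, π, hπ⟩ := hF.exists_cover (pullback (F.map f) (F.map w))
  obtain ⟨p, hp⟩ := hF.exists_map_eq (π ≫ pullback.fst _ _)
  obtain ⟨q, hq⟩ := hF.exists_map_eq (π ≫ pullback.snd _ _)
  exact ⟨V, p, q, hF.isWeakPullback_of_isRegularEpi π hp.symm hq.symm⟩

theorem hasWeakFiniteLimits (hF : IsProjectiveCover F) : HasWeakFiniteLimits P := by
  intro K _ _ D
  have := hF.full
  have := hF.faithful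
  obtain ⟨V, π, hπ⟩ := hF.exists_cover (limit (D ⋙ F))
  refine ⟨⟨V, { app := fun k => F.preimage (π ≫ limit.π (D ⋙ F) k), naturality := ?_ }⟩,
    fun s => ?_⟩
  · intro j k f
    apply F.map_injective
    simpa using congrArg (π ≫ ·) (limit.w (D ⋙ F) f).symm
  · obtain ⟨l, hl⟩ := hF.exists_lift_map π (limit.lift (D ⋙ F) (F.mapCone s))
    refine ⟨⟨l, fun k => F.map_injective ?_⟩⟩
    simp [reassoc_of% hl]

end IsProjectiveCover

/-! ### Presentations of objects of `E` -/

/-- `y₁, y₂ : Y₁ ⇉ Y₀` presents the object `Y` of `E`: `y : F Y₀ ⟶ Y` is a regular epimorphism, of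
which `y₁, y₂` is a weak kernel pair among the objects in the image of `F`. -/
structure IsPresentation {P : Type u₁} [Category.{v₁} P] {E : Type u₂} [Category.{v₂} E]
    (F : P ⥤ E) {Y₁ Y₀ : P} (y₁ y₂ : Y₁ ⟶ Y₀) {Y : E} (y : F.obj Y₀ ⟶ Y) : Prop where
  isRegularEpi : IsRegularEpi y
  w : F.map y₁ ≫ y = F.map y₂ ≫ y
  exists_lift : ∀ ⦃T : P⦄ (a b : T ⟶ Y₀), F.map a ≫ y = F.map b ≫ y →
    ∃ t : T ⟶ Y₁, t ≫ y₁ = a ∧ t ≫ y₂ = b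

namespace IsProjectiveCover

variable {P : Type u₁} [Category.{v₁} P] {E : Type u₂} [Category.{v₂} E] {F : P ⥤ E}

/-- Cover `Y`, then cover the kernel pair of that cover; reflexivity, symmetry and transitivity are
instances of weak universality. -/
theorem exists_isPresentation [Regular E] (hF : IsProjectiveCover F) (Y : E) :
    ∃ (Y₁ Y₀ : P) (y₁ y₂ : Y₁ ⟶ Y₀) (y : F.obj Y₀ ⟶ Y),
      IsPseudoEquivalenceRelation y₁ y₂ ∧ IsPresentation F y₁ y₂ y := by
  obtain ⟨Y₀, y, hy⟩ := hF.exists_cover Y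
  obtain ⟨Y₁, π, hπ⟩ := hF.exists_cover (pullback y y)
  obtain ⟨y₁, hy₁⟩ := hF.exists_map_eq (π ≫ pullback.fst _ _)
  obtain ⟨y₂, hy₂⟩ := hF.exists_map_eq (π ≫ pullback.snd _ _)
  have h : IsPresentation F y₁ y₂ y := by
    refine ⟨hy, by simp only [hy₁, hy₂, Category.assoc, pullback.condition], fun T a b hab => ?_⟩
    obtain ⟨t, ht⟩ := hF.exists_lift_map π (pullback.lift _ _ hab)
    refine ⟨t, hF.map_inj ?_, hF.map_inj ?_⟩
    · rw [F.map_comp, hy₁, reassoc_of% ht, pullback.lift_fst]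
    · rw [F.map_comp, hy₂, reassoc_of% ht, pullback.lift_snd]
  refine ⟨Y₁, Y₀, y₁, y₂, y, ⟨h.exists_lift _ _ rfl, h.exists_lift _ _ h.w.symm, ?_⟩, h⟩
  obtain ⟨T, a, b, hab⟩ := hF.exists_isWeakPullback y₂ y₁
  refine ⟨T, a, b, hab, h.exists_lift _ _ ?_⟩
  rw [F.map_comp, F.map_comp, Category.assoc, Category.assoc, h.w, ← F.map_comp_assoc,
    hab.w, F.map_comp_assoc, h.w]

/-- The image `R` of `Y₁` in `F Y₀ ⨯ F Y₀` is an honest equivalence relation, effective by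
exactness. Projectivity lifts pairs in `R` back to `Y₁`, so its quotient is presented by `y₁, y₂`.
-/
theorem exists_isPresentation_of_isPseudoEquivalenceRelation [IsExact E]
    (hF : IsProjectiveCover F) {Y₁ Y₀ : P} {y₁ y₂ : Y₁ ⟶ Y₀}
    (h : IsPseudoEquivalenceRelation y₁ y₂) :
    ∃ (Y : E) (y : F.obj Y₀ ⟶ Y), IsPresentation F y₁ y₂ y := by
  let φ : F.obj Y₁ ⟶ F.obj Y₀ ⨯ F.obj Y₀ := prod.lift (F.map y₁) (F.map y₂)
  let M := Regular.strongEpiMonoFactorisation φ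
  let R := M.I
  let e : F.obj Y₁ ⟶ R := M.e
  let m : R ⟶ F.obj Y₀ ⨯ F.obj Y₀ := M.m
  have he : IsRegularEpi e := inferInstanceAs (IsRegularEpi M.e)
  have hm : Mono m := M.m_mono
  have fac : e ≫ m = φ := M.fac
  let r₁ : R ⟶ F.obj Y₀ := m ≫ prod.fst
  let r₂ : R ⟶ F.obj Y₀ := m ≫ prod.snd
  have he₁ : e ≫ r₁ = F.map y₁ := by rw [reassoc_of% fac, prod.lift_fst]
  have he₂ : e ≫ r₂ = F.map y₂ := by rw [reassoc_of% fac, prod.lift_snd]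
  have hmono : ∀ ⦃Z : E⦄ (f g : Z ⟶ R), f ≫ r₁ = g ≫ r₁ → f ≫ r₂ = g ≫ r₂ → f = g := by
    intro Z f g h₁ h₂
    rw [← cancel_mono m]
    ext
    · simpa [r₁] using h₁
    · simpa [r₂] using h₂
  -- Membership in the subobject `R` is local: it suffices to find a witness in `Y₁` after a strong
  -- epimorphism.
  have loc : ∀ ⦃T' T : E⦄ (p : T' ⟶ T) [StrongEpi p] (a b : T ⟶ F.obj Y₀) (l : T' ⟶ F.obj Y₁),
      l ≫ F.map y₁ = p ≫ a → l ≫ F.map y₂ = p ≫ b → ∃ s : T ⟶ R, s ≫ r₁ = a ∧ s ≫ r₂ = b := by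
    intro T' T p _ a b l h₁ h₂
    obtain ⟨s, hs⟩ := exists_factor_of_strongEpi p m (t := prod.lift a b) (l := l ≫ e) (by
      rw [Category.assoc, fac]
      ext
      · rw [Category.assoc, Category.assoc, prod.lift_fst, prod.lift_fst, h₁]
      · rw [Category.assoc, Category.assoc, prod.lift_snd, prod.lift_snd, h₂])
    exact ⟨s, by rw [reassoc_of% hs, prod.lift_fst], by rw [reassoc_of% hs, prod.lift_snd]⟩
  obtain ⟨r, hr₁, hr₂⟩ := h.refl
  obtain ⟨s, hs₁, hs₂⟩ := h.symm
  obtain ⟨T, a, b, hab, t, ht₁, ht₂⟩ := h.trans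
  obtain ⟨s', hs'₁, hs'₂⟩ := loc e r₂ r₁ (F.map s)
    (by rw [← F.map_comp, hs₁, he₂]) (by rw [← F.map_comp, hs₂, he₁])
  obtain ⟨t', ht'₁, ht'₂⟩ : ∃ t' : pullback r₂ r₁ ⟶ R,
      t' ≫ r₁ = pullback.fst r₂ r₁ ≫ r₁ ∧ t' ≫ r₂ = pullback.snd r₂ r₁ ≫ r₂ := by
    -- Over a projective cover, composable pairs in `R` lift to `Y₁`, where the weak transitivity
    -- applies.
    obtain ⟨S, c, hc⟩ := hF.exists_cover (pullback r₂ r₁)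
    obtain ⟨a', ha'⟩ := hF.exists_lift_map e (c ≫ pullback.fst _ _)
    obtain ⟨b', hb'⟩ := hF.exists_lift_map e (c ≫ pullback.snd _ _)
    obtain ⟨k, rfl, rfl⟩ := hab.exists_lift a' b' (hF.map_inj (by
      rw [F.map_comp, F.map_comp, ← he₂, ← he₁, reassoc_of% ha', reassoc_of% hb',
        pullback.condition]))
    refine loc c _ _ (F.map (k ≫ t)) ?_ ?_
    · rw [← F.map_comp, Category.assoc, ht₁, ← Category.assoc, F.map_comp, ← he₁,
        reassoc_of% ha']
    · rw [← F.map_comp, Category.assoc, ht₂, ← Category.assoc, F.map_comp, ← he₂,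
        reassoc_of% hb']
  have heq : IsEquivalenceRelation r₁ r₂ := ⟨⟨
    { right_cancellation := hmono
      r := F.map r ≫ e
      reflexivity₁ := by rw [Category.assoc, he₁, ← F.map_comp, hr₁, F.map_id]
      reflexivity₂ := by rw [Category.assoc, he₂, ← F.map_comp, hr₂, F.map_id]
      s := s'
      symmetry₁ := hs'₁
      symmetry₂ := hs'₂
      c := pullback.cone r₂ r₁
      isLimit := pullback.isLimit r₂ r₁
      t := t'
      transitivity₁ := ht'₁
      transitivity₂ := ht'₂ }⟩⟩
  obtain ⟨⟨q⟩⟩ := IsExact.effective r₁ r₂ heq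
  refine ⟨q.B, q.π, inferInstance, ?_, fun T a b hab => ?_⟩
  · rw [← he₁, ← he₂, Category.assoc e, Category.assoc e, q.isKernelPair.w]
  · obtain ⟨l, hl⟩ := hF.exists_lift_map e (q.isKernelPair.lift _ _ hab)
    refine ⟨l, hF.map_inj ?_, hF.map_inj ?_⟩
    · rw [F.map_comp, ← he₁, reassoc_of% hl, IsKernelPair.lift_fst]
    · rw [F.map_comp, ← he₂, reassoc_of% hl, IsKernelPair.lift_snd]

end IsProjectiveCover

/-! ### Diagrams in `P` as morphisms out of pullbacks in `E` -/

variable {P : Type u₁} [Category.{v₁} P] {E : Type u₂} [Category.{v₂} E] {F : P ⥤ E}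

/-- The diagrams on `y₁, y₂` correspond to morphisms over `F X` from a pullback of `F f` to the
object presented by `y₁, y₂`: here, the morphism induced by a diagram. -/
theorem IsProjectiveCover.exists_desc_diagram [Regular E] (hF : IsProjectiveCover F)
    {Y₁ Y₀ X J : P} {y₁ y₂ : Y₁ ⟶ Y₀} {g : Y₀ ⟶ X} {f : X ⟶ J} {Y : E} {y : F.obj Y₀ ⟶ Y}
    (hy : IsPresentation F y₁ y₂ y) (D : DependentProductDiagram y₁ y₂ g f) :
    ∃ (π : F.obj D.V ⟶ pullback (F.map f) (F.map D.w)) (e : pullback (F.map f) (F.map D.w) ⟶ Y),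
      IsRegularEpi π ∧ π ≫ pullback.fst _ _ = F.map D.p ∧ π ≫ pullback.snd _ _ = F.map D.q ∧
      π ≫ e = F.map D.e ≫ y := by
  have hw : F.map D.p ≫ F.map f = F.map D.q ≫ F.map D.w := by
    rw [← F.map_comp, ← F.map_comp, D.isWeakPullback.w]
  have hπ := hF.isRegularEpi_lift D.isWeakPullback hw
  let π := pullback.lift (F.map D.p) (F.map D.q) hw
  have hp : π ≫ pullback.fst _ _ = F.map D.p := pullback.lift_fst _ _ _
  have hq : π ≫ pullback.snd _ _ = F.map D.q := pullback.lift_snd _ _ _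
  -- A pair identified by `π` factors, over a cover from `P`, through the equality `v₁, v₂`, which
  -- `e` sends into `Y₁`; `y` identifies the result.
  have desc : ∀ {Z : E} (a b : Z ⟶ F.obj D.V), a ≫ π = b ≫ π →
      a ≫ F.map D.e ≫ y = b ≫ F.map D.e ≫ y := by
    intro Z a b hab
    obtain ⟨S, c, hc⟩ := hF.exists_cover Z
    obtain ⟨a', ha'⟩ := hF.exists_map_eq (c ≫ a)
    obtain ⟨b', hb'⟩ := hF.exists_map_eq (c ≫ b)
    obtain ⟨V₁, v₁, v₂, hv, t, ht₁, ht₂⟩ := D.preservesProjections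
    obtain ⟨s, rfl, rfl⟩ := hv.exists_lift a' b'
      (hF.map_inj (by rw [F.map_comp, F.map_comp, ha', hb', ← hp, Category.assoc,
        Category.assoc, reassoc_of% hab]))
      (hF.map_inj (by rw [F.map_comp, F.map_comp, ha', hb', ← hq, Category.assoc,
        Category.assoc, reassoc_of% hab]))
    rw [← cancel_epi c, ← reassoc_of% ha', ← reassoc_of% hb', ← F.map_comp_assoc,
      ← F.map_comp_assoc, Category.assoc, Category.assoc, ← ht₁, ← ht₂]
    simp only [F.map_comp, Category.assoc, hy.w]
  exact ⟨π, EffectiveEpi.desc π (F.map D.e ≫ y) desc, hπ, hp, hq, EffectiveEpi.fac _ _ _⟩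

/-- Every morphism over `F X` from a pullback of `F f` to the object presented by `y₁, y₂` is
induced by a diagram on `y₁, y₂`, which can be chosen weakly universal. -/
theorem IsProjectiveCover.exists_diagram [Regular E] (hF : IsProjectiveCover F)
    {Y₁ Y₀ X J W : P} {y₁ y₂ : Y₁ ⟶ Y₀} {g : Y₀ ⟶ X} {f : X ⟶ J} {Y : E} {y : F.obj Y₀ ⟶ Y}
    (hy : IsPresentation F y₁ y₂ y) {g' : Y ⟶ F.obj X} (hg : y ≫ g' = F.map g) (w : W ⟶ J)
    (e' : pullback (F.map f) (F.map w) ⟶ Y) (he' : e' ≫ g' = pullback.fst _ _) :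
    ∃ (V : P) (q : V ⟶ W) (p : V ⟶ X) (e : V ⟶ Y₀)
      (π : F.obj V ⟶ pullback (F.map f) (F.map w)),
      e ≫ g = p ∧ IsWeakPullback p q f w ∧ PreservesProjections p q y₁ y₂ e ∧
      IsRegularEpi π ∧ π ≫ pullback.fst _ _ = F.map p ∧ π ≫ pullback.snd _ _ = F.map q ∧
      π ≫ e' = F.map e ≫ y ∧
      ∀ ⦃S : P⦄ (u : F.obj S ⟶ pullback (F.map f) (F.map w)) (a : S ⟶ X) (b : S ⟶ W)
        (c : S ⟶ Y₀), u ≫ pullback.fst _ _ = F.map a → u ≫ pullback.snd _ _ = F.map b →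
        u ≫ e' = F.map c ≫ y → ∃ β : S ⟶ V, β ≫ p = a ∧ β ≫ q = b ∧ β ≫ e = c := by
  have := hy.isRegularEpi
  -- Covering the pullback of `e'` and `y`, rather than just the domain of `e'`, makes every
  -- representative in `Y₀` of a value of `e'` occur; hence the weak universality.
  obtain ⟨V, κ, hκ⟩ := hF.exists_cover (pullback e' y)
  let π : F.obj V ⟶ pullback (F.map f) (F.map w) := κ ≫ pullback.fst e' y
  have hπ : IsRegularEpi π := isRegularEpi_comp _ _
  obtain ⟨p, hp⟩ := hF.exists_map_eq (π ≫ pullback.fst _ _)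
  obtain ⟨q, hq⟩ := hF.exists_map_eq (π ≫ pullback.snd _ _)
  obtain ⟨e, he⟩ := hF.exists_map_eq (κ ≫ pullback.snd e' y)
  have hπe : π ≫ e' = F.map e ≫ y := by
    rw [he, Category.assoc, Category.assoc, pullback.condition]
  refine ⟨V, q, p, e, π, hF.map_inj ?_, hF.isWeakPullback_of_isRegularEpi π hp.symm hq.symm, ?_,
    hπ, hp.symm, hq.symm, hπe, ?_⟩
  · rw [F.map_comp, ← hg, ← reassoc_of% hπe, he', hp]
  · obtain ⟨V₁, k, hk⟩ := hF.exists_cover (pullback π π)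
    obtain ⟨v₁, hv₁⟩ := hF.exists_map_eq (k ≫ pullback.fst π π)
    obtain ⟨v₂, hv₂⟩ := hF.exists_map_eq (k ≫ pullback.snd π π)
    have hv : F.map v₁ ≫ π = F.map v₂ ≫ π := by
      rw [hv₁, hv₂, Category.assoc, Category.assoc, pullback.condition]
    refine ⟨V₁, v₁, v₂, ⟨hF.map_inj ?_, hF.map_inj ?_, fun T a b hap haq => ?_⟩,
      hy.exists_lift _ _ ?_⟩
    · rw [F.map_comp, F.map_comp, hp, reassoc_of% hv]
    · rw [F.map_comp, F.map_comp, hq, reassoc_of% hv]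
    · obtain ⟨t, ht⟩ := hF.exists_lift_map k (pullback.lift (F.map a) (F.map b) (by
        ext
        · rw [Category.assoc _ π, Category.assoc _ π, ← hp, ← F.map_comp, hap, F.map_comp]
        · rw [Category.assoc _ π, Category.assoc _ π, ← hq, ← F.map_comp, haq, F.map_comp]))
      refine ⟨t, hF.map_inj ?_, hF.map_inj ?_⟩
      · rw [F.map_comp, hv₁, reassoc_of% ht, pullback.lift_fst]
      · rw [F.map_comp, hv₂, reassoc_of% ht, pullback.lift_snd]
    · rw [F.map_comp, F.map_comp, Category.assoc, Category.assoc, ← hπe, reassoc_of% hv]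
  · intro S u a b c ha hb hc
    obtain ⟨β, hβ⟩ := hF.exists_lift_map κ (pullback.lift u (F.map c) hc)
    have hβπ : F.map β ≫ π = u := by rw [reassoc_of% hβ, pullback.lift_fst]
    refine ⟨β, hF.map_inj ?_, hF.map_inj ?_, hF.map_inj ?_⟩
    · rw [F.map_comp, hp, reassoc_of% hβπ, ha]
    · rw [F.map_comp, hq, reassoc_of% hβπ, hb]
    · rw [F.map_comp, he, reassoc_of% hβ, pullback.lift_snd]

/-! ### Weak dependent products, between `P` and `E` -/

/-- `w : W ⟶ J` and the evaluation morphism `e` form a dependent product of `g : Y ⟶ X` along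
`f : X ⟶ J`, weakly universal with respect to the object `T`. -/
def IsWeakDependentProduct [HasPullbacks E] {X J Y W : E} (f : X ⟶ J) (g : Y ⟶ X) (w : W ⟶ J)
    (e : pullback f w ⟶ Y) (T : E) : Prop :=
  ∀ (t : T ⟶ J) (h : pullback f t ⟶ Y), h ≫ g = pullback.fst f t →
    ∃ (a : T ⟶ W) (ha : pullback.fst f t ≫ f = (pullback.snd f t ≫ a) ≫ w), a ≫ w = t ∧
      pullback.lift (pullback.fst f t) (pullback.snd f t ≫ a) ha ≫ e = h

/-- Present `Y` and take the generalised weak dependent product for that presentation. A test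
morphism in `E` from an object of `P` is represented by a diagram, which therefore maps to the
universal one. -/
theorem IsProjectiveCover.exists_isWeakDependentProduct [Regular E] (hF : IsProjectiveCover F)
    (hP : HasGeneralisedWeakDependentProducts P) {X J : P} (f : X ⟶ J) {Y : E}
    (g' : Y ⟶ F.obj X) :
    ∃ (W : P) (w : F.obj W ⟶ F.obj J) (e : pullback (F.map f) w ⟶ Y),
      e ≫ g' = pullback.fst _ _ ∧
      ∀ T : P, IsWeakDependentProduct (F.map f) g' w e (F.obj T) := by
  obtain ⟨Y₁, Y₀, y₁, y₂, y, hpy, hy⟩ := hF.exists_isPresentation Y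
  have := hy.isRegularEpi
  obtain ⟨g, hg⟩ := hF.exists_map_eq (y ≫ g')
  obtain ⟨D, hD⟩ := hP y₁ y₂ hpy g f
    (hF.map_inj (by rw [F.map_comp, F.map_comp, hg, reassoc_of% hy.w]))
  obtain ⟨π, e, hπ, hp, hq, he⟩ := hF.exists_desc_diagram hy D
  refine ⟨D.W, F.map D.w, e, ?_, fun T t h hh => ?_⟩
  · rw [← cancel_epi π, reassoc_of% he, ← hg, ← F.map_comp, D.comm, hp]
  · obtain ⟨t, rfl⟩ := hF.exists_map_eq t
    obtain ⟨V, q, p, e', π', hpe, hwp, hpp, hπ', hp', hq', he', -⟩ :=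
      hF.exists_diagram hy hg.symm t h hh
    obtain ⟨a, b, ha, hbq, hbp, hbe⟩ := hD ⟨T, V, t, q, p, e', hpe, hwp, hpp⟩
    dsimp only at a b ha hbq hbp hbe
    have hat : F.map a ≫ F.map D.w = F.map t := by rw [← F.map_comp, ha]
    refine ⟨F.map a, by rw [Category.assoc, hat, pullback.condition], hat, ?_⟩
    rw [← cancel_epi π', he', ← hbe, F.map_comp, Category.assoc (F.map b), ← he,
      ← Category.assoc π', ← Category.assoc (F.map b)]
    congr 1
    ext
    · rw [Category.assoc, pullback.lift_fst, hp', Category.assoc, hp, ← F.map_comp, hbp]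
    · rw [Category.assoc, pullback.lift_snd, reassoc_of% hq', Category.assoc, hq, ← F.map_comp,
        ← F.map_comp, hbq]

/-- The diagram represents the evaluation of the dependent product `Q` in `E`, pulled back to a
cover `W` of `Q`. Maps to `Q` lift to `W` by projectivity, and `exists_diagram` then lifts
representatives to `V`. -/
theorem IsProjectiveCover.hasGeneralisedWeakDependentProducts [IsExact E]
    (hF : IsProjectiveCover F)
    (hE : ∀ ⦃X J Y : E⦄ (f : X ⟶ J) (g : Y ⟶ X), ∃ (W : E) (w : W ⟶ J) (e : pullback f w ⟶ Y),
      e ≫ g = pullback.fst _ _ ∧ ∀ T, IsWeakDependentProduct f g w e T) :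
    HasGeneralisedWeakDependentProducts P := by
  intro Y₁ Y₀ X J y₁ y₂ hpy g f hgy
  obtain ⟨Y, y, hy⟩ := hF.exists_isPresentation_of_isPseudoEquivalenceRelation hpy
  have := hy.isRegularEpi
  obtain ⟨g', hg'⟩ : ∃ g' : Y ⟶ F.obj X, y ≫ g' = F.map g := by
    refine ⟨EffectiveEpi.desc y (F.map g) fun {Z} a b hab => ?_, EffectiveEpi.fac _ _ _⟩
    obtain ⟨S, c, hc⟩ := hF.exists_cover Z
    obtain ⟨a', ha'⟩ := hF.exists_map_eq (c ≫ a)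
    obtain ⟨b', hb'⟩ := hF.exists_map_eq (c ≫ b)
    obtain ⟨t, rfl, rfl⟩ := hy.exists_lift a' b'
      (by rw [ha', hb', Category.assoc, Category.assoc, hab])
    rw [← cancel_epi c, ← reassoc_of% ha', ← reassoc_of% hb', ← F.map_comp, ← F.map_comp,
      Category.assoc, Category.assoc, hgy]
  obtain ⟨Q, r, ev, hev, hQ⟩ := hE (F.map f) g'
  obtain ⟨W, c, hc⟩ := hF.exists_cover Q
  obtain ⟨w, hw⟩ := hF.exists_map_eq (c ≫ r)
  have hcr : pullback.fst (F.map f) (F.map w) ≫ F.map f = (pullback.snd _ _ ≫ c) ≫ r := by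
    rw [Category.assoc, ← hw, pullback.condition]
  obtain ⟨V, q, p, e, π, hpe, hwp, hpp, hπ, hp, hq, he, hV⟩ := hF.exists_diagram hy hg' w
    (pullback.lift _ _ hcr ≫ ev) (by rw [Category.assoc, hev, pullback.lift_fst])
  refine ⟨⟨W, V, w, q, p, e, hpe, hwp, hpp⟩, fun D => ?_⟩
  obtain ⟨π', e', hπ', hp', hq', he'⟩ := hF.exists_desc_diagram hy D
  obtain ⟨a, ha, haw, hae⟩ := hQ _ (F.map D.w) e' (by
    rw [← cancel_epi π', reassoc_of% he', hg', ← F.map_comp, D.comm, hp'])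
  obtain ⟨α, hα⟩ := hF.exists_lift_map c a
  have hαw : F.map α ≫ F.map w = F.map D.w := by rw [hw, reassoc_of% hα, haw]
  have hcond : F.map D.p ≫ F.map f = (F.map D.q ≫ F.map α) ≫ F.map w := by
    rw [Category.assoc, hαw, ← F.map_comp, ← F.map_comp, D.isWeakPullback.w]
  obtain ⟨β, hβp, hβq, hβe⟩ := hV (pullback.lift _ _ hcond) D.p (D.q ≫ α) D.e
    (pullback.lift_fst _ _ _) (by rw [pullback.lift_snd, F.map_comp]) (by
      rw [← he', ← hae, ← Category.assoc, ← Category.assoc]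
      congr 1
      ext
      · simp only [Category.assoc, pullback.lift_fst, hp']
      · simp only [Category.assoc, pullback.lift_snd, pullback.lift_snd_assoc, hα,
          reassoc_of% hq'])
  exact ⟨α, β, hF.map_inj (by rw [F.map_comp, hαw]), hβq, hβp, hβe⟩

/-! ### Universal quantification and weak exponentials -/

theorem exists_image [Regular E] {A B : E} (f : A ⟶ B) :
    ∃ (I : E) (i : A ⟶ I) (m : I ⟶ B), IsRegularEpi i ∧ Mono m ∧ i ≫ m = f :=
  let M := Regular.strongEpiMonoFactorisation f
  ⟨M.I, M.e, M.m, inferInstance, M.m_mono, M.fac⟩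

/-- Universal quantification, along `c`, of the equality of `m₁` and `m₂`. -/
theorem IsProjectiveCover.exists_forall_eq [Regular E] (hF : IsProjectiveCover F)
    (hP : HasGeneralisedWeakDependentProducts P) {C B Z : E} (c : C ⟶ B) (m₁ m₂ : C ⟶ Z) :
    ∃ (N : E) (n : N ⟶ B), Mono n ∧ ∀ ⦃T : E⦄ (t : T ⟶ B), (∃ s : T ⟶ N, s ≫ n = t) ↔
      ∀ ⦃S : E⦄ (u : S ⟶ C) (v : S ⟶ T), u ≫ c = v ≫ t → u ≫ m₁ = u ≫ m₂ := by
  -- Covering `B`, then the pullback of `C`, replaces `c` by an arrow `f` of `P`.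
  obtain ⟨J, b, hb⟩ := hF.exists_cover B
  obtain ⟨X, x, hx⟩ := hF.exists_cover (pullback c b)
  obtain ⟨f, hf⟩ := hF.exists_map_eq (x ≫ pullback.snd c b)
  obtain ⟨x', hxx⟩ : ∃ x' : F.obj X ⟶ C, x' = x ≫ pullback.fst c b := ⟨_, rfl⟩
  have hx' : F.map f ≫ b = x' ≫ c := by
    rw [hf, hxx, Category.assoc, Category.assoc, pullback.condition]
  obtain ⟨M, ι, hι, hM⟩ : ∃ (M : E) (ι : M ⟶ F.obj X), ι ≫ x' ≫ m₁ = ι ≫ x' ≫ m₂ ∧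
      ∀ {T : E} (t : T ⟶ F.obj X), t ≫ x' ≫ m₁ = t ≫ x' ≫ m₂ → ∃ l, l ≫ ι = t :=
    ⟨equalizer (x' ≫ m₁) (x' ≫ m₂), equalizer.ι _ _, equalizer.condition _ _,
      fun t h => ⟨equalizer.lift t h, equalizer.lift_ι _ _⟩⟩
  obtain ⟨W, w, e, he, hW⟩ := hF.exists_isWeakDependentProduct hP f ι
  -- `ι` is an equaliser, so only the existence of a section of it matters: passing to the image
  -- loses nothing and gives a subobject of `B`.
  obtain ⟨N, i, n, hi, hn, fac⟩ := exists_image (w ≫ b)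
  refine ⟨N, n, hn, fun T t => ⟨?_, fun h => ?_⟩⟩
  · rintro ⟨s, rfl⟩ S u v huv
    obtain ⟨S', k, l, hk, hl⟩ := hF.exists_cover_lift i (v ≫ s)
    obtain ⟨S'', k', l', hk', hl'⟩ := hF.exists_cover_lift x
      (pullback.lift (k ≫ u) (l ≫ w) (by
        rw [Category.assoc, huv, Category.assoc, ← fac, reassoc_of% hl]))
    have h₁ : l' ≫ x' = k' ≫ k ≫ u := by
      rw [hxx, reassoc_of% hl', pullback.lift_fst]
    have h₂ : l' ≫ F.map f = (k' ≫ l) ≫ w := by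
      rw [hf, reassoc_of% hl', pullback.lift_snd, Category.assoc]
    have h₃ : l' ≫ x' ≫ m₁ = l' ≫ x' ≫ m₂ := by
      rw [← pullback.lift_fst l' (k' ≫ l) h₂, ← he]
      simp only [Category.assoc, hι]
    rw [← cancel_epi k, ← cancel_epi k']
    simpa only [reassoc_of% h₁] using h₃
  · obtain ⟨T', k, l, hk, hl⟩ := hF.exists_cover_lift b t
    obtain ⟨d, hd⟩ := hM (pullback.fst (F.map f) l) (by
      rw [← Category.assoc, ← Category.assoc]
      refine h (pullback.fst _ _ ≫ x') (pullback.snd _ _ ≫ k) ?_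
      rw [Category.assoc, ← hx', pullback.condition_assoc, Category.assoc, hl])
    obtain ⟨a, -, ha, -⟩ := hW T' l d hd
    exact exists_factor_of_strongEpi k n (l := a ≫ i)
      (by rw [Category.assoc, fac, reassoc_of% ha, hl])

/-- The base change `c` of the regular epimorphism `X ⟶ A ×_I J` along `A ×_I T ⟶ A ×_I J` factors
through the morphism in question. -/
theorem isRegularEpi_pullback_lift [Regular E] {X A J I T : E} {x : X ⟶ A} {f : X ⟶ J} {a : A ⟶ I}
    {j : J ⟶ I} (h : x ≫ a = f ≫ j) [IsRegularEpi (pullback.lift x f h)] (t : T ⟶ J)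
    (ht : (pullback.fst f t ≫ x) ≫ a = pullback.snd f t ≫ t ≫ j) :
    IsRegularEpi (pullback.lift (pullback.fst f t ≫ x) (pullback.snd f t) ht) := by
  let k : pullback a (t ≫ j) ⟶ pullback a j := pullback.lift (pullback.fst _ _)
    (pullback.snd _ _ ≫ t) (by rw [Category.assoc, pullback.condition])
  let c := pullback.fst k (pullback.lift x f h)
  let l := pullback.snd k (pullback.lift x f h)
  have hc : IsRegularEpi c := inferInstance
  have hl : c ≫ k = l ≫ pullback.lift x f h := pullback.condition
  have hlx : l ≫ x = c ≫ pullback.fst _ _ := by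
    simpa only [Category.assoc, k, pullback.lift_fst] using congr($hl.symm ≫ pullback.fst _ _)
  have hlf : l ≫ f = (c ≫ pullback.snd _ _) ≫ t := by
    simpa only [Category.assoc, k, pullback.lift_snd] using congr($hl.symm ≫ pullback.snd _ _)
  have : pullback.lift _ _ hlf ≫ pullback.lift (pullback.fst f t ≫ x) (pullback.snd f t) ht
      = c := by
    ext
    · rw [Category.assoc, pullback.lift_fst, pullback.lift_fst_assoc, hlx]
    · rw [Category.assoc, pullback.lift_snd, pullback.lift_snd]
  have : IsRegularEpi (pullback.lift _ _ hlf ≫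
      pullback.lift (pullback.fst f t ≫ x) (pullback.snd f t) ht) := by
    rw [this]
    exact hc
  exact isRegularEpi_of_comp (pullback.lift _ _ hlf) _

/-- A weak exponential of `b : B ⟶ I` by `a : A ⟶ I`. -/
theorem IsProjectiveCover.exists_weakExponential [Regular E] (hF : IsProjectiveCover F)
    (hP : HasGeneralisedWeakDependentProducts P) {A B I : E} (a : A ⟶ I) (b : B ⟶ I) :
    ∃ (W : E) (w : W ⟶ I) (e : pullback a w ⟶ B), e ≫ b = pullback.fst _ _ ≫ a ∧
      ∀ (T : P) (t : F.obj T ⟶ I) (h : pullback a t ⟶ B), h ≫ b = pullback.fst _ _ ≫ a →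
        ∃ (α : F.obj T ⟶ W) (hα : pullback.fst a t ≫ a = (pullback.snd a t ≫ α) ≫ w),
          α ≫ w = t ∧ pullback.lift _ _ hα ≫ e = h := by
  obtain ⟨J, j, hj⟩ := hF.exists_cover I
  obtain ⟨X, y, hy⟩ := hF.exists_cover (pullback a j)
  obtain ⟨f, hf⟩ := hF.exists_map_eq (y ≫ pullback.snd a j)
  obtain ⟨x, hx⟩ : ∃ x : F.obj X ⟶ A, x = y ≫ pullback.fst a j := ⟨_, rfl⟩
  have hxa : x ≫ a = F.map f ≫ j := by
    rw [hf, hx, Category.assoc, Category.assoc, pullback.condition]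
  have : IsRegularEpi (pullback.lift x (F.map f) hxa) := by
    convert hy
    ext
    · rw [pullback.lift_fst, hx]
    · rw [pullback.lift_snd, hf]
  have hτ : ∀ {T : E} (t : T ⟶ F.obj J), ∃ τ : pullback (F.map f) t ⟶ pullback a (t ≫ j),
      IsRegularEpi τ ∧ τ ≫ pullback.fst _ _ = pullback.fst _ _ ≫ x ∧
        τ ≫ pullback.snd _ _ = pullback.snd _ _ := fun t =>
    ⟨_, isRegularEpi_pullback_lift hxa t
      (by rw [Category.assoc, hxa, pullback.condition_assoc]), pullback.lift_fst _ _ _,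
      pullback.lift_snd _ _ _⟩
  -- `U` weakly parametrises morphisms to `B` from the fibres of `X`, which cover those of `A`.
  obtain ⟨U, u, e, he, hU⟩ := hF.exists_isWeakDependentProduct hP f
    (pullback.fst (x ≫ a) b)
  obtain ⟨e', he'⟩ : ∃ e' : pullback (F.map f) u ⟶ B, e' = e ≫ pullback.snd _ _ := ⟨_, rfl⟩
  have he'b : e' ≫ b = pullback.fst _ _ ≫ x ≫ a := by
    rw [he', Category.assoc, ← pullback.condition, reassoc_of% he]
  obtain ⟨χ, -, hχ₁, hχ₂⟩ := hτ u
  -- The part of `U` on which `e'` only depends on the image in `A`.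
  obtain ⟨W, n, hn, hW⟩ := hF.exists_forall_eq hP (pullback.fst χ χ ≫ χ ≫ pullback.snd _ _)
    (pullback.fst χ χ ≫ e') (pullback.snd χ χ ≫ e')
  obtain ⟨r, hr⟩ : ∃ r, r = n ≫ u := ⟨_, rfl⟩
  obtain ⟨ρ, hρ, hρ₁, hρ₂⟩ := hτ r
  have hμ : pullback.fst (F.map f) r ≫ F.map f = (pullback.snd _ _ ≫ n) ≫ u := by
    rw [Category.assoc, ← hr, pullback.condition]
  obtain ⟨μ, hμ₁, hμ₂⟩ : ∃ μ : pullback (F.map f) r ⟶ pullback (F.map f) u,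
      μ ≫ pullback.fst _ _ = pullback.fst _ _ ∧
      μ ≫ pullback.snd _ _ = pullback.snd _ _ ≫ n :=
    ⟨pullback.lift _ _ hμ, pullback.lift_fst _ _ _, pullback.lift_snd _ _ _⟩
  -- By the choice of `W`, the restricted evaluation coequalises the kernel pair of `ρ`, so it
  -- descends from `X` to `A`.
  have desc : ∀ {Z : E} (g₁ g₂ : Z ⟶ pullback (F.map f) r), g₁ ≫ ρ = g₂ ≫ ρ →
      g₁ ≫ μ ≫ e' = g₂ ≫ μ ≫ e' := by
    intro Z g₁ g₂ hg
    have h₁ : g₁ ≫ pullback.fst _ _ ≫ x = g₂ ≫ pullback.fst _ _ ≫ x := by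
      rw [← hρ₁, reassoc_of% hg]
    have h₂ : g₁ ≫ pullback.snd _ _ = g₂ ≫ pullback.snd _ _ := by
      rw [← hρ₂, reassoc_of% hg]
    have hl : (g₁ ≫ μ) ≫ χ = (g₂ ≫ μ) ≫ χ := by
      ext
      · simp only [Category.assoc, hχ₁, reassoc_of% hμ₁, h₁]
      · simp only [Category.assoc, hχ₂, hμ₂, reassoc_of% h₂]
    have := (hW n).1 ⟨𝟙 _, Category.id_comp _⟩ (pullback.lift _ _ hl) (g₁ ≫ pullback.snd _ _) (by
      rw [pullback.lift_fst_assoc, hχ₂, Category.assoc, Category.assoc, hμ₂])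
    simpa only [pullback.lift_fst_assoc, pullback.lift_snd_assoc, Category.assoc] using this
  obtain ⟨γ, hγ⟩ : ∃ γ : pullback a (r ≫ j) ⟶ B, ρ ≫ γ = μ ≫ e' :=
    ⟨EffectiveEpi.desc ρ (μ ≫ e') desc, EffectiveEpi.fac _ _ _⟩
  refine ⟨W, r ≫ j, γ, ?_, fun T t h hh => ?_⟩
  · rw [← cancel_epi ρ, reassoc_of% hγ, he'b, reassoc_of% hρ₁, reassoc_of% hμ₁]
  obtain ⟨t', rfl⟩ := hF.exists_lift j t
  obtain ⟨τ, hτ, hτ₁, hτ₂⟩ := hτ t'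
  obtain ⟨α₀, hα₀, hα₀u, hα₀e⟩ := hU T t' (pullback.lift (pullback.fst _ _) (τ ≫ h)
    (by rw [Category.assoc, hh, reassoc_of% hτ₁])) (pullback.lift_fst _ _ _)
  obtain ⟨ν, hν₁, hν₂, hν⟩ : ∃ ν : pullback (F.map f) t' ⟶ pullback (F.map f) u,
      ν ≫ pullback.fst _ _ = pullback.fst _ _ ∧ ν ≫ pullback.snd _ _ = pullback.snd _ _ ≫ α₀ ∧
      ν ≫ e' = τ ≫ h :=
    ⟨pullback.lift _ _ hα₀, pullback.lift_fst _ _ _, pullback.lift_snd _ _ _, by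
      rw [he', reassoc_of% hα₀e, pullback.lift_snd]⟩
  -- The function named by `α₀` is `h` composed with the cover `τ`, so it depends only on the point
  -- of `A`; hence `α₀` lands in `W`.
  obtain ⟨α, rfl⟩ : ∃ α, α ≫ n = α₀ := by
    refine (hW α₀).2 fun S y v hyv => ?_
    have hc : (y ≫ pullback.fst χ χ) ≫ χ = (y ≫ pullback.snd χ χ) ≫ χ := by
      rw [Category.assoc, Category.assoc, pullback.condition]
    have key : ∀ z : S ⟶ pullback (F.map f) u, z ≫ χ = (y ≫ pullback.fst χ χ) ≫ χ →
        ∃ z' : S ⟶ pullback (F.map f) t', z' ≫ ν = z ∧ z' ≫ pullback.snd _ _ = v := by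
      intro z hz
      have hzv : z ≫ pullback.snd _ _ = v ≫ α₀ := by
        rw [← hyv, ← hχ₂, reassoc_of% hz]
      have hzt : (z ≫ pullback.fst _ _) ≫ F.map f = v ≫ t' := by
        rw [Category.assoc, pullback.condition, reassoc_of% hzv, hα₀u]
      refine ⟨pullback.lift _ _ hzt, ?_, pullback.lift_snd _ _ _⟩
      ext
      · rw [Category.assoc, hν₁, pullback.lift_fst]
      · rw [Category.assoc, hν₂, pullback.lift_snd_assoc, hzv]
    obtain ⟨z₁, hz₁, hz₁v⟩ := key _ rfl
    obtain ⟨z₂, hz₂, hz₂v⟩ := key _ hc.symm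
    have hz : z₁ ≫ τ = z₂ ≫ τ := by
      ext
      · rw [Category.assoc, Category.assoc, hτ₁, ← hν₁, Category.assoc, reassoc_of% hz₁,
          reassoc_of% hz₂, ← hχ₁, ← Category.assoc, ← Category.assoc]
        simpa only [Category.assoc] using congr($hc ≫ pullback.fst _ _)
      · rw [Category.assoc, Category.assoc, hτ₂, hz₁v, hz₂v]
    rw [← Category.assoc, ← Category.assoc, ← hz₁, ← hz₂, Category.assoc, Category.assoc, hν,
      reassoc_of% hz]
  have hαj : α ≫ r ≫ j = t' ≫ j := by rw [hr, ← hα₀u]; simp only [Category.assoc]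
  have hσ : pullback.fst (F.map f) t' ≫ F.map f = (pullback.snd (F.map f) t' ≫ α) ≫ r := by
    rw [pullback.condition, hr, ← hα₀u]; simp only [Category.assoc]
  refine ⟨α, by rw [Category.assoc, hαj, pullback.condition], hαj, ?_⟩
  have h₁ : τ ≫ pullback.lift (pullback.fst a (t' ≫ j)) (pullback.snd a (t' ≫ j) ≫ α)
      (by rw [Category.assoc, hαj, pullback.condition]) = pullback.lift _ _ hσ ≫ ρ := by
    ext
    · rw [Category.assoc τ, Category.assoc _ ρ, pullback.lift_fst, hρ₁, pullback.lift_fst_assoc, hτ₁]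
    · rw [Category.assoc τ, Category.assoc _ ρ, pullback.lift_snd, hρ₂, pullback.lift_snd,
        reassoc_of% hτ₂]
  have h₂ : pullback.lift _ _ hσ ≫ μ = ν := by
    ext
    · rw [Category.assoc, hμ₁, hν₁, pullback.lift_fst]
    · rw [Category.assoc, hμ₂, hν₂, pullback.lift_snd_assoc, Category.assoc]
  rw [← cancel_epi τ, reassoc_of% h₁, hγ, reassoc_of% h₂, hν]

/-! ### Exponentials in slices as quotients of weak exponentials -/

section Slices

open MonoidalCategory CartesianMonoidalCategory

attribute [local instance] Over.cartesianMonoidalCategory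

/-- Tensoring in `Over I` is pullback over `I`, so `A ◁ u` is a base change of `u` by pullback
pasting. -/
theorem isRegularEpi_whiskerLeft_left [Regular E] {I : E} (A : Over I) {T' T : Over I}
    (u : T' ⟶ T) [hu : IsRegularEpi u.left] : IsRegularEpi (A ◁ u).left := by
  refine Regular.regularEpiIsStableUnderBaseChange.of_isPullback
    (f' := (snd A T').left) (g := u.left) (f := (snd A T).left) (IsPullback.flip ?_) hu
  refine IsPullback.of_right (h₁₂ := (fst A T).left) (v₁₃ := A.hom) (h₂₂ := T.hom) ?_ ?_
    (IsPullback.of_hasPullback A.hom T.hom)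
  · rw [← Over.comp_left, whiskerLeft_fst, Over.w]
    exact IsPullback.of_hasPullback A.hom T'.hom
  · rw [← Over.comp_left, ← Over.comp_left, whiskerLeft_snd]

theorem epi_whiskerLeft [Regular E] {I : E} (A : Over I) {T' T : Over I}
    (u : T' ⟶ T) [IsRegularEpi u.left] : Epi (A ◁ u) :=
  have := isRegularEpi_whiskerLeft_left A u
  Over.epi_of_epi_left _

/-- Morphisms out of `A ⊗ -` descend along regular epimorphisms. -/
theorem exists_whiskerLeft_comp_eq [Regular E] {I : E} {A B : Over I} {T' T : Over I}
    (u : T' ⟶ T) [IsRegularEpi u.left] (h : A ⊗ T' ⟶ B)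
    (H : ∀ {Z : Over I} (a b : Z ⟶ T'), a ≫ u = b ≫ u → A ◁ a ≫ h = A ◁ b ≫ h) :
    ∃ k : A ⊗ T ⟶ B, A ◁ u ≫ k = h := by
  have := isRegularEpi_whiskerLeft_left A u
  have desc : ∀ {Z : E} (g₁ g₂ : Z ⟶ (A ⊗ T').left), g₁ ≫ (A ◁ u).left = g₂ ≫ (A ◁ u).left →
      g₁ ≫ h.left = g₂ ≫ h.left := by
    intro Z g₁ g₂ hg
    have hg₁ : g₁ ≫ (fst A T').left = g₂ ≫ (fst A T').left := by
      simpa only [Category.assoc, ← Over.comp_left, whiskerLeft_fst] using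
        congr($hg ≫ (fst A T).left)
    have hg₂ : g₁ ≫ (snd A T').left ≫ u.left = g₂ ≫ (snd A T').left ≫ u.left := by
      simpa only [Category.assoc, ← Over.comp_left, whiskerLeft_snd] using
        congr($hg ≫ (snd A T).left)
    let Z' : Over I := Over.mk (g₁ ≫ (A ⊗ T').hom)
    let g₁' : Z' ⟶ A ⊗ T' := Over.homMk g₁
    let g₂' : Z' ⟶ A ⊗ T' := Over.homMk g₂ (by
      change g₂ ≫ _ = g₁ ≫ _
      rw [← Over.w (fst A T'), ← reassoc_of% hg₁])
    have h₁ : g₁' ≫ fst A T' = g₂' ≫ fst A T' := Over.OverMorphism.ext hg₁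
    have h₂ : (g₁' ≫ snd A T') ≫ u = (g₂' ≫ snd A T') ≫ u :=
      Over.OverMorphism.ext
        ((Category.assoc _ _ _).trans (hg₂.trans (Category.assoc _ _ _).symm))
    have e₁ : g₁' = lift (g₁' ≫ fst A T') (𝟙 _) ≫ A ◁ (g₁' ≫ snd A T') := by
      apply CartesianMonoidalCategory.hom_ext <;> simp
    have e₂ : g₂' = lift (g₁' ≫ fst A T') (𝟙 _) ≫ A ◁ (g₂' ≫ snd A T') := by
      apply CartesianMonoidalCategory.hom_ext <;> simp [h₁]
    have : g₁' ≫ h = g₂' ≫ h := by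
      rw [e₁, e₂, Category.assoc, Category.assoc, H _ _ h₂]
    exact congr(($this).left)
  have hk : (A ◁ u).left ≫ EffectiveEpi.desc (A ◁ u).left h.left desc = h.left :=
    EffectiveEpi.fac _ _ _
  refine ⟨Over.homMk (EffectiveEpi.desc (A ◁ u).left h.left desc) ?_,
    Over.OverMorphism.ext hk⟩
  rw [← cancel_epi (A ◁ u).left, reassoc_of% hk, Over.w, Over.w]

/-- A weak exponential `W` has too many names for each function. Identifying names with the same
evaluation restores uniqueness, and gluing along covers extends existence from objects of `P` to all
of `Over I`. -/
theorem IsProjectiveCover.exists_exponential [IsExact E] (hF : IsProjectiveCover F)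
    (hP : HasGeneralisedWeakDependentProducts P) {I : E} (A B : Over I) :
    ∃ (Q : Over I) (ev : A ⊗ Q ⟶ B), ∀ {T : Over I} (h : A ⊗ T ⟶ B),
      ∃! α : T ⟶ Q, A ◁ α ≫ ev = h := by
  obtain ⟨W, γ, hγ⟩ : ∃ (W : Over I) (γ : A ⊗ W ⟶ B), ∀ (T : P) (t : F.obj T ⟶ I)
      (h : A ⊗ Over.mk t ⟶ B), ∃ α : Over.mk t ⟶ W, A ◁ α ≫ γ = h := by
    obtain ⟨W, w, e, he, hW⟩ := hF.exists_weakExponential hP A.hom B.hom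
    refine ⟨Over.mk w, Over.homMk e he, fun T t h => ?_⟩
    obtain ⟨α, hα, hαw, hαe⟩ := hW T t h.left (Over.w h)
    refine ⟨Over.homMk α hαw, Over.OverMorphism.ext ?_⟩
    rw [← hαe, Over.comp_left]
    change _ ≫ e = _
    congr 1
    apply Over.tensorObj_ext
    · exact (Over.whiskerLeft_left_fst _).trans (pullback.lift_fst _ _ _).symm
    · exact (Over.whiskerLeft_left_snd _).trans (pullback.lift_snd _ _ _).symm
  -- `N` is the subobject of `W ⊗ W` of pairs with equal evaluations on all of `A`: quantification
  -- along the projection `A ⊗ (W ⊗ W) ⟶ W ⊗ W`.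
  obtain ⟨N, p₁, p₂, hp, hmono, hN⟩ : ∃ (N : E) (p₁ p₂ : N ⟶ W.left),
      p₁ ≫ W.hom = p₂ ≫ W.hom ∧
      (∀ ⦃Z : E⦄ (a b : Z ⟶ N), a ≫ p₁ = b ≫ p₁ → a ≫ p₂ = b ≫ p₂ → a = b) ∧
      ∀ {T : Over I} (a b : T ⟶ W), (∃ s : T.left ⟶ N, s ≫ p₁ = a.left ∧ s ≫ p₂ = b.left) ↔
        A ◁ a ≫ γ = A ◁ b ≫ γ := by
    obtain ⟨N, n, hn, hN⟩ := hF.exists_forall_eq hP (snd A (W ⊗ W)).left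
      (A ◁ fst W W ≫ γ).left (A ◁ snd W W ≫ γ).left
    refine ⟨N, n ≫ (fst W W).left, n ≫ (snd W W).left, ?_, fun Z a b h₁ h₂ => ?_,
      fun {T} a b => ?_⟩
    · rw [Category.assoc, Category.assoc, Over.w, Over.w]
    · rw [← cancel_mono n]
      exact Over.tensorObj_ext _ _ (by simpa using h₁) (by simpa using h₂)
    · have h₁ : (∃ s : T.left ⟶ N, s ≫ n ≫ (fst W W).left = a.left ∧
          s ≫ n ≫ (snd W W).left = b.left) ↔ ∃ s, s ≫ n = (lift a b).left := by
        refine exists_congr fun s => ⟨fun ⟨ha, hb⟩ => ?_, fun h => ?_⟩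
        · apply Over.tensorObj_ext
          · rw [Category.assoc]
            exact ha.trans congr($((lift_fst a b).symm).left)
          · rw [Category.assoc]
            exact hb.trans congr($((lift_snd a b).symm).left)
        · rw [reassoc_of% h, reassoc_of% h, ← Over.comp_left, ← Over.comp_left, lift_fst,
            lift_snd]
          exact ⟨rfl, rfl⟩
      rw [h₁, hN]
      have e₁ : A ◁ lift a b ≫ A ◁ fst W W ≫ γ = A ◁ a ≫ γ := by
        rw [← whiskerLeft_comp_assoc, lift_fst]
      have e₂ : A ◁ lift a b ≫ A ◁ snd W W ≫ γ = A ◁ b ≫ γ := by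
        rw [← whiskerLeft_comp_assoc, lift_snd]
      refine ⟨fun h => ?_, fun h S u v huv => ?_⟩
      · ext
        rw [← e₁, ← e₂, Over.comp_left, Over.comp_left]
        refine h _ (snd A T).left ?_
        rw [← Over.comp_left, whiskerLeft_snd, Over.comp_left]
      · have hu : (u ≫ (fst A (W ⊗ W)).left) ≫ A.hom = v ≫ T.hom := by
          rw [Category.assoc, Over.w, ← Over.w (snd A (W ⊗ W)), reassoc_of% huv, Over.w]
        have : u = (pullback.lift _ _ hu : S ⟶ (A ⊗ T).left) ≫ (A ◁ lift a b).left := by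
          apply Over.tensorObj_ext
          · rw [Category.assoc, Over.whiskerLeft_left_fst, pullback.lift_fst]
            rfl
          · rw [Category.assoc, Over.whiskerLeft_left_snd, pullback.lift_snd_assoc]
            exact huv
        rw [this, Category.assoc, Category.assoc, ← Over.comp_left, ← Over.comp_left, e₁, e₂, h]
  have hrel : ∀ ⦃Z : E⦄ (a b : Z ⟶ W.left) (hab : a ≫ W.hom = b ≫ W.hom),
      (∃ s : Z ⟶ N, s ≫ p₁ = a ∧ s ≫ p₂ = b) ↔
        A ◁ (Over.homMk a rfl : Over.mk (a ≫ W.hom) ⟶ W) ≫ γ =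
          A ◁ (Over.homMk b hab.symm : Over.mk (a ≫ W.hom) ⟶ W) ≫ γ :=
    fun Z a b hab => hN (Over.homMk a rfl : Over.mk (a ≫ W.hom) ⟶ W) (Over.homMk b hab.symm)
  obtain ⟨r, hr₁, hr₂⟩ := (hrel (𝟙 _) (𝟙 _) rfl).2 rfl
  obtain ⟨s, hs₁, hs₂⟩ : ∃ s : N ⟶ N, s ≫ p₁ = p₂ ∧ s ≫ p₂ = p₁ :=
    (hN (Over.homMk p₂ hp.symm : Over.mk (p₁ ≫ W.hom) ⟶ W) (Over.homMk p₁ rfl)).2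
      ((hrel p₁ p₂ hp).1 ⟨𝟙 _, Category.id_comp _, Category.id_comp _⟩).symm
  obtain ⟨t, ht₁, ht₂⟩ : ∃ t : pullback p₂ p₁ ⟶ N,
      t ≫ p₁ = pullback.fst _ _ ≫ p₁ ∧ t ≫ p₂ = pullback.snd _ _ ≫ p₂ := by
    let Z : Over I := Over.mk (pullback.fst p₂ p₁ ≫ p₁ ≫ W.hom)
    let z₁ : Z ⟶ W := Over.homMk (pullback.fst p₂ p₁ ≫ p₁) (Category.assoc _ _ _)
    let z₂ : Z ⟶ W := Over.homMk (pullback.fst p₂ p₁ ≫ p₂) (by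
      rw [Category.assoc, ← hp]; rfl)
    let z₃ : Z ⟶ W := Over.homMk (pullback.snd p₂ p₁ ≫ p₂) (by
      rw [Category.assoc, ← hp, ← pullback.condition_assoc, ← hp]; rfl)
    exact (hN z₁ z₃).2 (((hN z₁ z₂).1 ⟨pullback.fst _ _, rfl, rfl⟩).trans
      ((hN z₂ z₃).1 ⟨pullback.snd _ _, pullback.condition.symm, rfl⟩))
  have heq : IsEquivalenceRelation p₁ p₂ := ⟨⟨
    { right_cancellation := hmono
      r := r
      reflexivity₁ := hr₁
      reflexivity₂ := hr₂
      s := s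
      symmetry₁ := hs₁
      symmetry₂ := hs₂
      c := pullback.cone p₂ p₁
      isLimit := pullback.isLimit p₂ p₁
      t := t
      transitivity₁ := ht₁
      transitivity₂ := ht₂ }⟩⟩
  obtain ⟨Q, π, hπ, hker⟩ : ∃ (Q : Over I) (π : W ⟶ Q), IsRegularEpi π.left ∧
      IsKernelPair π.left p₁ p₂ := by
    obtain ⟨⟨q⟩⟩ := IsExact.effective p₁ p₂ heq
    exact ⟨Over.mk (q.isPushout.desc W.hom W.hom hp),
      Over.homMk q.π (q.isPushout.inl_desc _ _ _), inferInstanceAs (IsRegularEpi q.π),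
      q.isKernelPair⟩
  obtain ⟨ev, hev⟩ := exists_whiskerLeft_comp_eq π γ (fun a b hab =>
    (hN a b).1 ⟨hker.lift a.left b.left congr(($hab).left), hker.lift_fst _ _ _,
      hker.lift_snd _ _ _⟩)
  have hπN : ∀ {T : Over I} (a b : T ⟶ W), A ◁ a ≫ γ = A ◁ b ≫ γ → a ≫ π = b ≫ π := by
    intro T a b hab
    obtain ⟨s, hs₁, hs₂⟩ := (hN a b).2 hab
    ext
    rw [Over.comp_left, Over.comp_left, ← hs₁, ← hs₂, Category.assoc, Category.assoc, hker.w]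
  refine ⟨Q, ev, fun {T} h => existsUnique_of_exists_of_unique ?_ fun α β hα hβ => ?_⟩
  · obtain ⟨S, c, hc⟩ := hF.exists_cover T.left
    let c' : Over.mk (c ≫ T.hom) ⟶ T := Over.homMk c
    have hc' : IsRegularEpi c'.left := hc
    obtain ⟨α₀, hα₀⟩ := hγ S (c ≫ T.hom) (A ◁ c' ≫ h)
    -- The names chosen over the cover `S` need not agree where `c` identifies points, but their
    -- evaluations do, so their classes in `Q` glue.
    have desc : ∀ {Z : E} (g₁ g₂ : Z ⟶ F.obj S), g₁ ≫ c = g₂ ≫ c →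
        g₁ ≫ (α₀ ≫ π).left = g₂ ≫ (α₀ ≫ π).left := by
      intro Z g₁ g₂ hg
      let g₁' : Over.mk (g₁ ≫ c ≫ T.hom) ⟶ Over.mk (c ≫ T.hom) := Over.homMk g₁
      have hg₂ : g₂ ≫ c ≫ T.hom = g₁ ≫ c ≫ T.hom := by rw [reassoc_of% hg]
      let g₂' : Over.mk (g₁ ≫ c ≫ T.hom) ⟶ Over.mk (c ≫ T.hom) := Over.homMk g₂ hg₂
      have hg' : g₁' ≫ c' = g₂' ≫ c' := Over.OverMorphism.ext hg
      have := hπN (g₁' ≫ α₀) (g₂' ≫ α₀) (by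
        rw [MonoidalCategory.whiskerLeft_comp, MonoidalCategory.whiskerLeft_comp,
          Category.assoc, Category.assoc, hα₀, ← whiskerLeft_comp_assoc,
          ← whiskerLeft_comp_assoc, hg'])
      rw [Category.assoc, Category.assoc] at this
      exact congr(($this).left)
    have hα : c ≫ EffectiveEpi.desc c (α₀ ≫ π).left desc = (α₀ ≫ π).left :=
      EffectiveEpi.fac _ _ _
    let α : T ⟶ Q := Over.homMk (EffectiveEpi.desc c (α₀ ≫ π).left desc) (by
      rw [← cancel_epi c, reassoc_of% hα, Over.w]
      rfl)
    have hα' : c' ≫ α = α₀ ≫ π := Over.OverMorphism.ext hα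
    have := epi_whiskerLeft A c'
    refine ⟨α, ?_⟩
    rw [← cancel_epi (A ◁ c'), ← whiskerLeft_comp_assoc, hα', whiskerLeft_comp_assoc, hev, hα₀]
  -- Uniqueness: over a cover, `α` and `β` lift to `W`, where equal evaluations force equal classes.
  · obtain ⟨S, c, l₁, hc, hl₁⟩ := hF.exists_cover_lift π.left α.left
    obtain ⟨l₂, hl₂⟩ := hF.exists_lift π.left (c ≫ β.left)
    let c' : Over.mk (c ≫ T.hom) ⟶ T := Over.homMk c
    let l₁' : Over.mk (c ≫ T.hom) ⟶ W := Over.homMk l₁ (by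
      rw [← Over.w π, reassoc_of% hl₁, Over.w]; rfl)
    let l₂' : Over.mk (c ≫ T.hom) ⟶ W := Over.homMk l₂ (by
      rw [← Over.w π, reassoc_of% hl₂, Over.w]; rfl)
    have h₁ : l₁' ≫ π = c' ≫ α := Over.OverMorphism.ext hl₁
    have h₂ : l₂' ≫ π = c' ≫ β := Over.OverMorphism.ext hl₂
    have := hπN l₁' l₂' (by
      rw [← hev, ← whiskerLeft_comp_assoc, ← whiskerLeft_comp_assoc, h₁, h₂,
        whiskerLeft_comp_assoc, whiskerLeft_comp_assoc, hα, hβ])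
    rw [h₁, h₂] at this
    ext
    rw [← cancel_epi c]
    exact congr(($this).left)

theorem isLocallyCartesianClosed_of_exists_exponential [HasPullbacks E]
    (h : ∀ {I : E} (A B : Over I), ∃ (Q : Over I) (ev : A ⊗ Q ⟶ B),
      ∀ {T : Over I} (h : A ⊗ T ⟶ B), ∃! α : T ⟶ Q, A ◁ α ≫ ev = h) :
    IsLocallyCartesianClosed E := by
  intro I
  choose Q ev hQ using @h I
  let e (A T B : Over I) : ((tensorLeft A).obj T ⟶ B) ≃ (T ⟶ Q A B) :=
    (Equiv.ofBijective (fun α : T ⟶ Q A B => (A ◁ α ≫ ev A B : A ⊗ T ⟶ B))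
      (Function.bijective_iff_existsUnique _ |>.2 fun h => hQ A B h)).symm
  refine ⟨⟨fun A => ⟨_, Adjunction.adjunctionOfEquivRight (G_obj := Q A) (e A) ?_⟩⟩⟩
  intro T' T B f g
  apply (e A T' B).symm.injective
  rw [Equiv.symm_apply_apply]
  change _ = A ◁ (f ≫ e A T B g) ≫ ev A B
  rw [whiskerLeft_comp_assoc]
  exact congr(A ◁ f ≫ $(((e A T B).symm_apply_apply g).symm))

/-! ### Dependent products from exponentials -/

/-- The dependent product is the object of sections of `γ : B ⟶ A` in `Over J`: the part of the
exponential of `B` by `A` on which composition with `γ` (`m₁`) equals the constant name of the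
identity of `A` (`m₂`). -/
theorem IsLocallyCartesianClosed.exists_dependentProduct [HasFiniteLimits E]
    (hE : IsLocallyCartesianClosed E) {X J Y : E} (f : X ⟶ J) (g : Y ⟶ X) :
    ∃ (W : E) (w : W ⟶ J) (e : pullback f w ⟶ Y),
      e ≫ g = pullback.fst _ _ ∧ ∀ T, IsWeakDependentProduct f g w e T := by
  obtain ⟨_⟩ := hE J
  let A : Over J := Over.mk f
  let B : Over J := Over.mk (g ≫ f)
  let γ : B ⟶ A := Over.homMk g
  let H := (ihom A).obj B
  let m₁ : H ⟶ (ihom A).obj A := (ihom A).map γ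
  let m₂ : H ⟶ (ihom A).obj A := MonoidalClosed.curry (fst A H)
  let Q : Over J := Over.mk (equalizer.ι m₁.left m₂.left ≫ H.hom)
  let ι : Q ⟶ H := Over.homMk (equalizer.ι m₁.left m₂.left)
  have hι : ι ≫ m₁ = ι ≫ m₂ := Over.OverMorphism.ext (equalizer.condition _ _)
  have hev : MonoidalClosed.uncurry ι ≫ γ = fst A Q := by
    rw [← MonoidalClosed.uncurry_natural_right, hι, MonoidalClosed.uncurry_natural_left,
      MonoidalClosed.uncurry_curry, whiskerLeft_fst]
  refine ⟨Q.left, Q.hom, (MonoidalClosed.uncurry ι).left, congr(($hev).left), fun T t h hh => ?_⟩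
  let T' : Over J := Over.mk t
  let h' : A ⊗ T' ⟶ B := Over.homMk h (by
    change h ≫ g ≫ f = _
    rw [reassoc_of% hh]
    rfl)
  have hh' : h' ≫ γ = fst A T' := Over.OverMorphism.ext hh
  have hm : MonoidalClosed.curry h' ≫ m₁ = MonoidalClosed.curry h' ≫ m₂ := by
    rw [← MonoidalClosed.curry_natural_right, ← MonoidalClosed.curry_natural_left, hh',
      whiskerLeft_fst]
  let a : T' ⟶ Q := Over.homMk (equalizer.lift (MonoidalClosed.curry h').left congr(($hm).left))
    (by
      change equalizer.lift _ _ ≫ equalizer.ι _ _ ≫ H.hom = _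
      rw [equalizer.lift_ι_assoc, Over.w])
  have ha : a ≫ ι = MonoidalClosed.curry h' := Over.OverMorphism.ext (equalizer.lift_ι _ _)
  have hae : A ◁ a ≫ MonoidalClosed.uncurry ι = h' := by
    rw [← MonoidalClosed.uncurry_natural_left, ha, MonoidalClosed.uncurry_curry]
  have haw : a.left ≫ Q.hom = t := Over.w a
  refine ⟨a.left, by rw [Category.assoc, haw, pullback.condition], haw, ?_⟩
  refine Eq.trans ?_ congr(($hae).left)
  rw [Over.comp_left]
  congr 1
  refine pullback.hom_ext ?_ ?_
  · exact (pullback.lift_fst _ _ _).trans (Over.whiskerLeft_left_fst (R := A) a).symm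
  · exact (pullback.lift_snd _ _ _).trans (Over.whiskerLeft_left_snd (R := A) a).symm

end Slices

end WeakLCC

theorem mainTheorem2 {P : Type u₁} [Category.{v₁} P]
    {E : Type u₂} [Category.{v₂} E] [WeakLCC.IsExact E]
    (F : P ⥤ E) (hF : WeakLCC.IsProjectiveCover F) :
    WeakLCC.IsLocallyCartesianClosed E ↔ WeakLCC.IsWeaklyLocallyCartesianClosed P :=
  ⟨fun hE => ⟨hF.hasWeakFiniteLimits,
    hF.hasGeneralisedWeakDependentProducts fun _ _ _ f g => hE.exists_dependentProduct f g⟩,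
  fun hP => WeakLCC.isLocallyCartesianClosed_of_exists_exponential fun A B =>
    hF.exists_exponential hP.hasGeneralisedWeakDependentProducts A B⟩
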